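/- Let $A\in GL(d,\mathbb{R})$, $B\in\mathbb{R}^{d\times m}$, and let $U\subset\mathbb{R}^m$ be a compact convex neighborhood of $0$ with $U=\overline{\operatorname{int}U}$. Consider the discrete-time linear control system $$x_{k+1}=Ax_k+Bu_k,\qquad u=(u_k)_{k\ge 0}\in\mathcal{U}:=U^{\mathbb{N}_0},$$ with solutions $\varphi(k,x,u)$, $\varphi(0,x,u)=x$. Assume that $(A,B)$ is controllable, i.e. $\operatorname{rank}[B\ AB\ \cdots\ A^{d-1}B]=d$, and that $A$ is hyperbolic, i.e. $|\lambda|\neq 1$ for every (complex) eigenvalue $\lambda$ of $A$. A control set is a nonvoid set $D\subset\mathbb{R}^d$ that is maximal (with respect to inclusion) with the properties (i) $D\subset\overline{\mathbf{R}(x)}$ for all $x\in D$, where $\mathbf{R}(x)=\{\varphi(k,x,u) : k\ge 1,\ u\in\mathcal{U}\}$, and (ii) for every $x\in D$ there is $u\in\mathcal{U}$ with $\varphi(k,x,u)\in D$ for all $k\ge 1$. Let $D$ be the unique control set with nonvoid interior. For a compact set $K\subset D$ and an integer $\tau\ge 1$, a set $\mathcal{S}\subset\mathcal{U}$ is called $(\tau,K,D)$-spanning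 if for every $x\in K$ there is $u\in\mathcal{S}$ with $\varphi(k,x,u)\in D$ for all $k\in\{1,\dots,\tau\}$. For $f\in C(U,\mathbb{R})$ put $$a_\tau(f,K,D)=\inf\Big\{\sum_{u\in\mathcal{S}}e^{\sum_{i=0}^{\tau-1}f(u_i)} : \mathcal{S}\ (\tau,K,D)\text{-spanning}\Big\},\qquad P_{inv}(f,K,D)=\limsup_{\tau\to\infty}\frac1\tau\log a_\tau(f,K,D).$$ Let $A^+$ be the restriction of $A$ to its unstable subspace $E^u$, the sum of the real generalized eigenspaces for the eigenvalues $\lambda$ with $|\lambda|>1$ (and $\det A^+=1$ if $E^u=\{0\}$). Then for every $f\in C(U,\mathbb{R})$ and every compact set $K\subset D$ with nonvoid interior, $$P_{inv}(f,K,D)\le\log|\det A^+|+\inf_{(\tau,x,u)}\frac1\tau\sum_{i=0}^{\tau-1}f(u_i),$$ where the infimum is taken over all integers $\tau\ge 1$ with $\tau\ge d$, all $x\in\mathbb{R}^d$ and all $\tau$-periodic controls $u\in\mathcal{U}$ such that the trajectory $\varphi(\cdot,x,u)$ is $\tau$-periodic and contained in $\operatorname{int}D$, and $u_i\in\operatorname{int}U$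 for $i\in\{0,\dots,\tau-1\}$. -/

import Mathlib

open Set Filter Topology
open scoped Matrix ENNReal

noncomputable section

namespace InvPressure

/-! Discrete-time control systems `x_{k+1} = F x_k u_k` with state space `X` and
control range (as a type) `V`. Admissible controls are all sequences `ℕ → V`. -/

section General

variable {X V : Type*}

/-- The solution `φ(k, x, u)` of `x_{k+1} = F x_k u_k` with `x_0 = x`. -/
def traj (F : X → V → X) : ℕ → X → (ℕ → V) → X
  | 0, x, _ => x
  | k + 1, x, u => F (traj F k x u) (u k)

/-- The reachable set `R(x)`, the union of the sets `R_k(x)` over all `k ≥ 1`. -/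
def reachable (F : X → V → X) (x : X) : Set X :=
  {y | ∃ k : ℕ, 1 ≤ k ∧ ∃ u : ℕ → V, traj F k x u = y}

/-- A control set: a nonvoid set that is maximal (for inclusion) with the two properties
of approximate controllability and of controlled invariance. -/
def IsControlSet [TopologicalSpace X] (F : X → V → X) (D : Set X) : Prop :=
  Maximal (fun E : Set X => E.Nonempty ∧
    (∀ x ∈ E, E ⊆ closure (reachable F x)) ∧
    (∀ x ∈ E, ∃ u : ℕ → V, ∀ k : ℕ, 1 ≤ k → traj F k x u ∈ E)) D

/-- `(τ, K, Q)`-spanning sets of controls. -/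
def IsSpanning (F : X → V → X) (τ : ℕ) (K Q : Set X) (S : Set (ℕ → V)) : Prop :=
  ∀ x ∈ K, ∃ u ∈ S, ∀ k : ℕ, 1 ≤ k → k ≤ τ → traj F k x u ∈ Q

/-- The sum `(S_τ f)(u) = f(u_0) + ... + f(u_{τ-1})`. -/
def potentialSum (f : V → ℝ) (τ : ℕ) (u : ℕ → V) : ℝ :=
  ∑ i ∈ Finset.range τ, f (u i)

/-- `a_τ(f, K, Q)`: the infimum over all `(τ, K, Q)`-spanning sets of the (possibly infinite)
sums of `exp ((S_τ f)(u))`, with value in `[0, ∞]`. -/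
def spanningInf (F : X → V → X) (f : V → ℝ) (K Q : Set X) (τ : ℕ) : ℝ≥0∞ :=
  ⨅ (S : Set (ℕ → V)) (_ : IsSpanning F τ K Q S),
    ∑' u : S, ENNReal.ofReal (Real.exp (potentialSum f τ u))

/-- The invariance pressure, an extended real number:
the limit superior of `(1/τ) log a_τ(f, K, Q)` as `τ → ∞`. -/
def pressure (F : X → V → X) (f : V → ℝ) (K Q : Set X) : EReal :=
  limsup (fun τ : ℕ => (((1 : ℝ) / (τ : ℝ) : ℝ) : EReal) *
    ENNReal.log (spanningInf F f K Q τ)) atTop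

end General

section Linear

variable {d m : ℕ}

/-- The right-hand side `(x, u) ↦ A x + B u`, with controls `u` restricted to `U`. -/
def linSys (A : Matrix (Fin d) (Fin d) ℝ) (B : Matrix (Fin d) (Fin m) ℝ)
    (U : Set (Fin m → ℝ)) : (Fin d → ℝ) → U → (Fin d → ℝ) :=
  fun x u => A *ᵥ x + B *ᵥ (u : Fin m → ℝ)

/-- The block matrix `[B, AB, ..., A^{d-1}B]`. -/
def kalmanMatrix (A : Matrix (Fin d) (Fin d) ℝ) (B : Matrix (Fin d) (Fin m) ℝ) :
    Matrix (Fin d) (Fin d × Fin m) ℝ :=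
  Matrix.of fun i kj => (A ^ (kj.1 : ℕ) * B) i kj.2

/-- Controllability of the pair `(A, B)`. -/
def IsControllable (A : Matrix (Fin d) (Fin d) ℝ) (B : Matrix (Fin d) (Fin m) ℝ) : Prop :=
  (kalmanMatrix A B).rank = d

/-- The endomorphism of `ℂ^d` given by the real matrix `A`. -/
def complexEnd (A : Matrix (Fin d) (Fin d) ℝ) : Module.End ℂ (Fin d → ℂ) :=
  Matrix.toLin' (A.map (fun r : ℝ => (r : ℂ)))

/-- `A` is hyperbolic: no complex eigenvalue has absolute value one. -/
def IsHyperbolic (A : Matrix (Fin d) (Fin d) ℝ) : Prop :=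
  ∀ μ : ℂ, (complexEnd A).HasEigenvalue μ → ‖μ‖ ≠ 1

/-- The sum in `ℂ^d` of the generalized eigenspaces for all `μ` with `|μ| > 1`. -/
def complexUnstable (A : Matrix (Fin d) (Fin d) ℝ) : Submodule ℂ (Fin d → ℂ) :=
  ⨆ (μ : ℂ) (_ : 1 < ‖μ‖), (complexEnd A).maxGenEigenspace μ

/-- The unstable subspace `E^u` of `A`: the real vectors in the sum of the complex
generalized eigenspaces for the eigenvalues `μ` with `|μ| > 1`. -/
def unstable (A : Matrix (Fin d) (Fin d) ℝ) : Submodule ℝ (Fin d → ℝ) :=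
  ((complexUnstable A).restrictScalars ℝ).comap
    (Complex.ofRealCLM.toLinearMap.compLeft (Fin d))

theorem complexUnstable_invariant (A : Matrix (Fin d) (Fin d) ℝ) (z : Fin d → ℂ)
    (hz : z ∈ complexUnstable A) : complexEnd A z ∈ complexUnstable A := by
  have h : complexUnstable A ≤ (complexUnstable A).comap (complexEnd A) := by
    refine iSup₂_le fun μ hμ w hw => ?_
    exact (le_iSup₂_of_le (f := fun (μ : ℂ) (_ : 1 < ‖μ‖) =>
      (complexEnd A).maxGenEigenspace μ) μ hμ le_rfl)
      (Module.End.mapsTo_maxGenEigenspace_of_comm (Commute.refl (complexEnd A)) μ hw)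
  exact h hz

theorem unstable_invariant (A : Matrix (Fin d) (Fin d) ℝ) :
    ∀ x ∈ unstable A, Matrix.toLin' A x ∈ unstable A := by
  intro x hx
  have h := complexUnstable_invariant A _ hx
  have e : complexEnd A (Complex.ofRealCLM.toLinearMap.compLeft (Fin d) x) =
      Complex.ofRealCLM.toLinearMap.compLeft (Fin d) (Matrix.toLin' A x) := by
    ext i
    simp [complexEnd, Matrix.mulVec, dotProduct]
  rw [e] at h
  exact h

/-- The unstable determinant `det A⁺`: the determinant of the restriction `A⁺` of `A` to
the unstable subspace (equal to `1` if that subspace is trivial). -/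
def unstableDet (A : Matrix (Fin d) (Fin d) ℝ) : ℝ :=
  LinearMap.det ((Matrix.toLin' A).restrict (unstable_invariant A))

/-- The triples `(τ, x, u)` with `τ ≥ d` positive such that the control `u` and the trajectory
starting in `x` are `τ`-periodic, the trajectory stays in `int D`, and `u_i ∈ int U`. -/
def IsPeriodicPair (A : Matrix (Fin d) (Fin d) ℝ) (B : Matrix (Fin d) (Fin m) ℝ)
    (U : Set (Fin m → ℝ)) (D : Set (Fin d → ℝ)) (τ : ℕ) (x : Fin d → ℝ) (u : ℕ → U) : Prop :=
  1 ≤ τ ∧ d ≤ τ ∧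
  (∀ k : ℕ, u (k + τ) = u k) ∧
  (∀ k : ℕ, traj (linSys A B U) (k + τ) x u = traj (linSys A B U) k x u) ∧
  (∀ k : ℕ, traj (linSys A B U) k x u ∈ interior D) ∧
  (∀ i : ℕ, i < τ → (u i : Fin m → ℝ) ∈ interior U)

end Linear

end InvPressure

end

/-!
Fix a `τ`-periodic pair `(x, u)` as in the infimum and an error `ε > 0`. It suffices to keep the
points of `K` in `D` with controls that, after a bounded time, stay `ε`-close in potential to `u`,
and to use at most `const * exp (n * (log |det A⁺| + ε))` of them up to time `n`.

*Counting.* By hyperbolicity, `ℝ^d` is spanned by the unstable subspace, on which the backward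
iterates of `A` are bounded, and the subspace of vectors with bounded forward orbits
(`unstable_sup_boundedOrbits`). Comparing volumes in the unstable subspace only,
the image of the unit ball under `A ^ n` is covered by `C * |det A⁺| ^ n` translates of the unit
ball, with `C` independent of `n` (`exists_finset_cover_pow`).

*Feedback blocks.* Let `T` be a large multiple of `τ`, so that `T ≥ d`, and let `p` run over the
centres of such a cover for `n = T`. The Kalman condition gives controls `v p` steering `0` to `-p`
in time `T` (`IsControllable.exists_traj_eq`). Any point of the unit ball is returned to the
unit ball in time `T` by one of the `v p`. By linearity the picture may be scaled by a small `ρ > 0`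
and added to the periodic trajectory: the controls `u + ρ v p` have values in `U`, keep the
ball of radius `ρ` around `x` in `D`, return it to itself in time `T`, and have almost the same
potential as `u` by continuity of `f` (`pressure_le_of_isPeriodicPair`).

*Assembly.* Control sets have the no-return property (`IsControlSet.traj_mem`), so by compactness
finitely many controls steer `K` into that ball without leaving `D`
(`IsControlSet.exists_finite_steering`). Following these by arbitrary concatenations of blocks gives
spanning sets of the required cardinality (`IsControlSet.pressure_le`), with exponential rate
`log (C * |det A⁺| ^ T) / T`; the contribution of `C` vanishes as `T → ∞`.
-/

namespace InvPressure

/-! ### Bounded orbits and the unstable subspace -/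

section Orbits

variable {𝕜 E : Type*} [NormedField 𝕜] [SeminormedAddCommGroup E] [NormedSpace 𝕜 E]

/-- The subspace of all vectors with a bounded forward orbit under `f`. -/
def boundedOrbits (f : Module.End 𝕜 E) : Submodule 𝕜 E where
  carrier := {z | ∃ C : ℝ, ∀ n : ℕ, ‖(f ^ n) z‖ ≤ C}
  zero_mem' := ⟨0, fun n => by simp⟩
  add_mem' := by
    rintro a b ⟨C, hC⟩ ⟨C', hC'⟩
    refine ⟨C + C', fun n => ?_⟩
    rw [map_add]
    exact (norm_add_le _ _).trans (add_le_add (hC n) (hC' n))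
  smul_mem' := by
    rintro c a ⟨C, hC⟩
    refine ⟨‖c‖ * C, fun n => ?_⟩
    rw [map_smul, norm_smul]
    exact mul_le_mul_of_nonneg_left (hC n) (norm_nonneg c)

theorem mem_boundedOrbits {f : Module.End 𝕜 E} {z : E} :
    z ∈ boundedOrbits f ↔ ∃ C : ℝ, ∀ n : ℕ, ‖(f ^ n) z‖ ≤ C := Iff.rfl

/-- The proof is by induction on the exponent `k` in `(f - μ) ^ k z = 0`: the vector
`w = (f - μ) z` has a bounded orbit, and `f ^ (n + 1) z = μ f ^ n z + f ^ n w`. -/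
theorem maxGenEigenspace_le_boundedOrbits (f : Module.End 𝕜 E) {μ : 𝕜} (hμ : ‖μ‖ < 1) :
    f.maxGenEigenspace μ ≤ boundedOrbits f := by
  intro z hz
  obtain ⟨k, hk⟩ := (Module.End.mem_maxGenEigenspace f μ z).1 hz
  clear hz
  induction k generalizing z with
  | zero =>
    have : z = 0 := by simpa using hk
    rw [this]
    exact Submodule.zero_mem _
  | succ k ih =>
    have hw := ih (z := (f - μ • (1 : Module.End 𝕜 E)) z) (by rw [pow_succ] at hk; exact hk)
    obtain ⟨C, hC⟩ := hw
    have h1 : 0 < 1 - ‖μ‖ := by linarith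
    -- `[0, M]` contains `‖z‖` and is mapped below `M` by `t ↦ ‖μ‖ * t + C`,
    -- as `C ≤ M * (1 - ‖μ‖)`.
    refine ⟨max ‖z‖ (C / (1 - ‖μ‖)), fun n => ?_⟩
    set M := max ‖z‖ (C / (1 - ‖μ‖)) with hM
    have hCM : C ≤ M * (1 - ‖μ‖) := (div_le_iff₀ h1).1 (le_max_right _ _)
    induction n with
    | zero => simp [hM]
    | succ n ihn =>
      have e : (f ^ (n + 1)) z
          = (f ^ n) ((f - μ • (1 : Module.End 𝕜 E)) z) + μ • (f ^ n) z := by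
        rw [← map_smul, ← map_add, pow_succ]
        simp
      rw [e]
      calc _ ≤ C + ‖μ‖ * M := (norm_add_le _ _).trans (add_le_add (hC n) (by
              rw [norm_smul]; exact mul_le_mul_of_nonneg_left ihn (norm_nonneg _)))
        _ ≤ M := by linarith

/-- The analogous statement for backward orbits: with `w = (f - μ) z` one has
`μ g ^ (n + 1) z = g ^ n z - g ^ (n + 1) w`. -/
theorem maxGenEigenspace_le_boundedOrbits_of_mul_eq_one (f g : Module.End 𝕜 E)
    (hgf : g * f = 1) {μ : 𝕜} (hμ : 1 < ‖μ‖) :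
    f.maxGenEigenspace μ ≤ boundedOrbits g := by
  intro z hz
  obtain ⟨k, hk⟩ := (Module.End.mem_maxGenEigenspace f μ z).1 hz
  clear hz
  have h0 : μ ≠ 0 := by
    rintro rfl
    simp at hμ
    linarith
  induction k generalizing z with
  | zero =>
    have : z = 0 := by simpa using hk
    rw [this]
    exact Submodule.zero_mem _
  | succ k ih =>
    have hw := ih (z := (f - μ • (1 : Module.End 𝕜 E)) z) (by rw [pow_succ] at hk; exact hk)
    obtain ⟨C, hC⟩ := hw
    have h1 : 0 < ‖μ‖ - 1 := by linarith
    -- `[0, M]` contains `‖z‖` and is mapped below `M` by `t ↦ (t + C) / ‖μ‖`,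
    -- as `C ≤ M * (‖μ‖ - 1)`.
    refine ⟨max ‖z‖ (C / (‖μ‖ - 1)), fun n => ?_⟩
    set M := max ‖z‖ (C / (‖μ‖ - 1)) with hM
    have hCM : C ≤ M * (‖μ‖ - 1) := (div_le_iff₀ h1).1 (le_max_right _ _)
    induction n with
    | zero => simp [hM]
    | succ n ihn =>
      have hgz : g (f z) = z := by
        rw [← Module.End.mul_apply, hgf, Module.End.one_apply]
      have e : μ • (g ^ (n + 1)) z
          = (g ^ n) z - (g ^ (n + 1)) ((f - μ • (1 : Module.End 𝕜 E)) z) := by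
        rw [pow_succ]
        simp [hgz]
      have e' : ‖μ‖ * ‖(g ^ (n + 1)) z‖ ≤ M + C := by
        rw [← norm_smul, e]
        exact (norm_sub_le _ _).trans (add_le_add ihn (hC _))
      have : ‖μ‖ * ‖(g ^ (n + 1)) z‖ ≤ ‖μ‖ * M := by linarith
      exact le_of_mul_le_mul_left this (by linarith)

end Orbits

/-- By the uniform boundedness principle, the orbits starting in a finite-dimensional subspace
of vectors with bounded orbits are bounded uniformly on the unit ball. -/
theorem exists_norm_pow_le {E : Type*} [NormedAddCommGroup E] [NormedSpace ℝ E]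
    [FiniteDimensional ℝ E] (f : Module.End ℝ E) (S : Submodule ℝ E)
    (hS : S ≤ boundedOrbits f) :
    ∃ C : ℝ, 0 ≤ C ∧ ∀ (n : ℕ), ∀ x ∈ S, ‖(f ^ n) x‖ ≤ C * ‖x‖ := by
  have : CompleteSpace S := FiniteDimensional.complete ℝ S
  let g : ℕ → S →L[ℝ] E := fun n => ((f ^ n) ∘ₗ S.subtype).toContinuousLinearMap
  obtain ⟨C, hC⟩ := banach_steinhaus (g := g) fun x => by
    obtain ⟨C, hC⟩ := mem_boundedOrbits.1 (hS x.2)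
    exact ⟨C, fun n => by simpa [g] using hC n⟩
  refine ⟨C, (norm_nonneg _).trans (hC 0), fun n x hx => ?_⟩
  have := (g n).le_of_opNorm_le (hC n) ⟨x, hx⟩
  simpa [g] using this

section Splitting

variable {d : ℕ}

/-- The inclusion of `ℝ^d` into `ℂ^d`. -/
noncomputable def ofRealVec (d : ℕ) : (Fin d → ℝ) →ₗ[ℝ] (Fin d → ℂ) :=
  Complex.ofRealCLM.toLinearMap.compLeft (Fin d)

@[simp] theorem ofRealVec_apply (x : Fin d → ℝ) (i : Fin d) : ofRealVec d x i = (x i : ℂ) := rfl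

theorem norm_ofRealVec (x : Fin d → ℝ) : ‖ofRealVec d x‖ = ‖x‖ := by
  simp [Pi.norm_def, nnnorm, ofRealVec]

theorem mem_unstable {A : Matrix (Fin d) (Fin d) ℝ} {x : Fin d → ℝ} :
    x ∈ unstable A ↔ ofRealVec d x ∈ complexUnstable A := Iff.rfl

theorem complexEnd_ofRealVec (A : Matrix (Fin d) (Fin d) ℝ) (x : Fin d → ℝ) :
    complexEnd A (ofRealVec d x) = ofRealVec d (Matrix.toLin' A x) := by
  ext i
  simp [complexEnd, Matrix.mulVec, dotProduct]

theorem complexEnd_pow_ofRealVec (A : Matrix (Fin d) (Fin d) ℝ) (n : ℕ) (x : Fin d → ℝ) :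
    (complexEnd A ^ n) (ofRealVec d x) = ofRealVec d ((Matrix.toLin' A ^ n) x) := by
  induction n generalizing x with
  | zero => simp
  | succ n ih => rw [pow_succ, pow_succ, Module.End.mul_apply, Module.End.mul_apply,
      complexEnd_ofRealVec, ih]

theorem complexEnd_star (A : Matrix (Fin d) (Fin d) ℝ) (z : Fin d → ℂ) :
    complexEnd A (star z) = star (complexEnd A z) := by
  ext i
  simp [complexEnd, Matrix.mulVec, dotProduct]

theorem complexEnd_pow_star (A : Matrix (Fin d) (Fin d) ℝ) (n : ℕ) (z : Fin d → ℂ) :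
    (complexEnd A ^ n) (star z) = star ((complexEnd A ^ n) z) := by
  induction n generalizing z with
  | zero => simp
  | succ n ih => rw [pow_succ, Module.End.mul_apply, Module.End.mul_apply, complexEnd_star, ih]

theorem star_mem_maxGenEigenspace (A : Matrix (Fin d) (Fin d) ℝ) {μ : ℂ} {z : Fin d → ℂ}
    (hz : z ∈ (complexEnd A).maxGenEigenspace μ) :
    star z ∈ (complexEnd A).maxGenEigenspace (star μ) := by
  rw [Module.End.mem_maxGenEigenspace] at hz ⊢
  obtain ⟨k, hk⟩ := hz
  refine ⟨k, ?_⟩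
  have key : ∀ w : Fin d → ℂ,
      ((complexEnd A - star μ • (1 : Module.End ℂ (Fin d → ℂ))) ^ k) (star w)
        = star (((complexEnd A - μ • (1 : Module.End ℂ (Fin d → ℂ))) ^ k) w) := by
    clear hk
    induction k with
    | zero => simp
    | succ k ih =>
      intro w
      rw [pow_succ, pow_succ, Module.End.mul_apply, Module.End.mul_apply, ← ih]
      congr 1
      simp [complexEnd_star]
  rw [key, hk, star_zero]

theorem star_mem_complexUnstable (A : Matrix (Fin d) (Fin d) ℝ) {z : Fin d → ℂ}
    (hz : z ∈ complexUnstable A) : star z ∈ complexUnstable A := by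
  have h : complexUnstable A ≤
      (complexUnstable A).comap (starLinearEquiv ℂ (A := Fin d → ℂ)).toLinearMap := by
    refine iSup₂_le fun μ hμ w hw => ?_
    exact (le_iSup₂_of_le (f := fun (μ : ℂ) (_ : 1 < ‖μ‖) =>
      (complexEnd A).maxGenEigenspace μ) (star μ) (by simpa using hμ) le_rfl)
      (star_mem_maxGenEigenspace A hw)
  exact h hz

/-- Backward orbits of unstable vectors are bounded. -/
theorem unstable_le_boundedOrbits {A A' : Matrix (Fin d) (Fin d) ℝ} (h : A' * A = 1) :
    unstable A ≤ boundedOrbits (Matrix.toLin' A') := by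
  intro x hx
  have h' : complexUnstable A ≤ boundedOrbits (complexEnd A') := by
    refine iSup₂_le fun μ hμ => maxGenEigenspace_le_boundedOrbits_of_mul_eq_one _ _ ?_ hμ
    have e := congrArg (fun M : Matrix (Fin d) (Fin d) ℝ => M.map Complex.ofRealHom) h
    simp only [Matrix.map_mul] at e
    rw [complexEnd, complexEnd, Module.End.mul_eq_comp, ← Matrix.toLin'_mul]
    have e2 : (A'.map fun r : ℝ => (r : ℂ)) * (A.map fun r : ℝ => (r : ℂ)) = 1 := by
      refine Eq.trans e ?_
      ext i j
      simp [Matrix.one_apply, apply_ite]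
    rw [e2, Matrix.toLin'_one]
    rfl
  obtain ⟨C, hC⟩ := mem_boundedOrbits.1 (h' (mem_unstable.1 hx))
  refine ⟨C, fun n => ?_⟩
  rw [← norm_ofRealVec, ← complexEnd_pow_ofRealVec]
  exact hC n

theorem complexUnstable_sup_boundedOrbits {A : Matrix (Fin d) (Fin d) ℝ} (hA : IsHyperbolic A) :
    complexUnstable A ⊔ boundedOrbits (complexEnd A) = ⊤ := by
  rw [eq_top_iff, ← Module.End.iSup_maxGenEigenspace_eq_top (complexEnd A)]
  refine iSup_le fun μ => ?_
  rcases lt_trichotomy ‖μ‖ 1 with h | h | h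
  · exact (maxGenEigenspace_le_boundedOrbits _ h).trans le_sup_right
  · have : (complexEnd A).maxGenEigenspace μ = ⊥ := by
      by_contra hne
      refine hA μ ?_ h
      rw [Submodule.eq_bot_iff] at hne
      push Not at hne
      obtain ⟨z, hz, hz0⟩ := hne
      obtain ⟨k, hk⟩ := (Module.End.mem_maxGenEigenspace _ μ z).1 hz
      refine Module.End.hasEigenvalue_of_hasGenEigenvalue (k := k) fun hbot => hz0 ?_
      have : z ∈ (complexEnd A).genEigenspace μ k := by
        rw [Module.End.mem_genEigenspace_nat]
        exact hk
      rw [hbot] at this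
      exact this
    rw [this]
    exact bot_le
  · exact (le_iSup₂_of_le (f := fun (μ : ℂ) (_ : 1 < ‖μ‖) =>
      (complexEnd A).maxGenEigenspace μ) μ h le_rfl).trans le_sup_left

/-- The complex splitting descends to real vectors, as the unstable part is stable under
complex conjugation. -/
theorem unstable_sup_boundedOrbits {A : Matrix (Fin d) (Fin d) ℝ} (hA : IsHyperbolic A) :
    unstable A ⊔ boundedOrbits (Matrix.toLin' A) = ⊤ := by
  rw [eq_top_iff]
  intro x _
  have hx : ofRealVec d x ∈ complexUnstable A ⊔ boundedOrbits (complexEnd A) := by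
    rw [complexUnstable_sup_boundedOrbits hA]
    trivial
  obtain ⟨a, ha, b, hb, hab⟩ := Submodule.mem_sup.1 hx
  let re : (Fin d → ℂ) → (Fin d → ℝ) := fun z i => (z i).re
  have hre : ∀ z, ofRealVec d (re z) = (2⁻¹ : ℂ) • (z + star z) := by
    intro z
    ext i
    simp only [ofRealVec_apply, re, Pi.smul_apply, Pi.add_apply, Pi.star_apply, smul_eq_mul]
    rw [Complex.star_def, Complex.add_conj]
    push_cast
    ring
  refine Submodule.mem_sup.2 ⟨re a, ?_, re b, ?_, ?_⟩
  · rw [mem_unstable, hre]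
    exact Submodule.smul_mem _ _ (Submodule.add_mem _ ha (star_mem_complexUnstable A ha))
  · obtain ⟨C, hC⟩ := hb
    refine ⟨C, fun n => ?_⟩
    rw [← norm_ofRealVec, ← complexEnd_pow_ofRealVec, hre, map_smul, map_add,
      complexEnd_pow_star, norm_smul]
    have h1 := norm_add_le ((complexEnd A ^ n) b) (star ((complexEnd A ^ n) b))
    rw [norm_star] at h1
    have h2 : ‖(2⁻¹ : ℂ)‖ = 2⁻¹ := by simp
    rw [h2]
    have := hC n
    linarith
  · ext i
    have := congrArg (fun z : Fin d → ℂ => (z i).re) hab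
    simpa [re] using this

end Splitting

/-! ### Covering the iterated unit ball -/

section Covering

open MeasureTheory Metric

/-- If `g` does not contract below the factor `1 / c`, the image under `g` of the ball of
radius `R` is covered by `(2 R + c) ^ dim * |det g|` unit balls: the balls of radius `1 / 2` around
a maximal `1`-separated subset are disjoint and lie in the image of the ball of
radius `R + c / 2`, whose volume is known. -/
theorem exists_finset_cover_image {E : Type*} [NormedAddCommGroup E] [NormedSpace ℝ E]
    [FiniteDimensional ℝ E] (g : E →ₗ[ℝ] E) {c R : ℝ} (hc0 : 0 ≤ c) (hR : 0 ≤ R)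
    (hg : ∀ x, ‖x‖ ≤ c * ‖g x‖) :
    ∃ P : Finset E, (P.card : ℝ) ≤ (2 * R + c) ^ Module.finrank ℝ E * |LinearMap.det g| ∧
      ∀ x, ‖x‖ ≤ R → ∃ p ∈ P, ‖g x - p‖ ≤ 1 := by
  borelize E
  let μ : Measure E := Measure.addHaar
  set n := Module.finrank ℝ E with hn
  have hinj : Function.Injective g := by
    rw [← LinearMap.ker_eq_bot, LinearMap.ker_eq_bot']
    intro x hx
    have := hg x
    rw [hx, norm_zero, mul_zero] at this
    exact norm_le_zero_iff.1 this
  have hsurj : Function.Surjective g := LinearMap.surjective_of_injective hinj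
  set s : Set E := g '' closedBall 0 R with hs
  set b : ℝ := (2 * R + c) ^ n * |LinearMap.det g| with hb
  have hb0 : 0 ≤ b := by positivity
  have card_le : ∀ P : Finset E, (P : Set E) ⊆ s → IsSeparated 1 (P : Set E) →
      (P.card : ℝ) ≤ b := by
    intro P hPs hsep
    have hdisj : (P : Set E).PairwiseDisjoint fun p => ball p (1 / 2 : ℝ) := by
      intro p hp q hq hpq
      refine ball_disjoint_ball ?_
      have h1 : 1 < edist p q := hsep hp hq hpq
      rw [edist_dist, ← ENNReal.ofReal_one] at h1
      have h2 : (1 : ℝ) < dist p q := (ENNReal.ofReal_lt_ofReal_iff_of_nonneg zero_le_one).1 h1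
      linarith
    have hsub : (⋃ p ∈ P, ball p (1 / 2 : ℝ)) ⊆ g '' closedBall 0 (R + c / 2) := by
      intro y hy
      obtain ⟨p, hp, hy⟩ := mem_iUnion₂.1 hy
      obtain ⟨x, hx, rfl⟩ := hPs hp
      obtain ⟨e, he⟩ := hsurj (y - g x)
      refine ⟨x + e, ?_, by rw [map_add, he]; abel⟩
      rw [mem_closedBall_zero_iff] at hx ⊢
      have h1 := hg e
      rw [he] at h1
      rw [mem_ball, dist_eq_norm] at hy
      have h2 : c * ‖y - g x‖ ≤ c * (1 / 2) := mul_le_mul_of_nonneg_left hy.le hc0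
      linarith [norm_add_le x e]
    have hvol := measure_mono (μ := μ) hsub
    rw [measure_biUnion_finset hdisj (fun p _ => measurableSet_ball),
      Measure.addHaar_image_linearMap, Measure.addHaar_closedBall _ _ (by positivity)] at hvol
    have hball : ∀ p : E, μ (ball p (1 / 2)) = ENNReal.ofReal ((1 / 2) ^ n) * μ (ball 0 1) :=
      fun p => Measure.addHaar_ball_of_pos μ p (by norm_num)
    simp only [hball, Finset.sum_const, nsmul_eq_mul] at hvol
    rw [← mul_assoc, ← mul_assoc] at hvol
    have h0 : μ (ball 0 1) ≠ 0 := (measure_ball_pos μ _ one_pos).ne'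
    have h1 : μ (ball 0 1) ≠ ⊤ := measure_ball_lt_top.ne
    have hvol := (ENNReal.mul_le_mul_iff_left h0 h1).1 hvol
    rw [← ENNReal.ofReal_natCast, ← ENNReal.ofReal_mul (by positivity),
      ← ENNReal.ofReal_mul (by positivity), ENNReal.ofReal_le_ofReal_iff (by positivity)] at hvol
    have e : (2 : ℝ) ^ n * (1 / 2) ^ n = 1 := by rw [← mul_pow]; norm_num
    have e' : (2 : ℝ) ^ n * (R + c / 2) ^ n = (2 * R + c) ^ n := by rw [← mul_pow]; ring_nf
    calc (P.card : ℝ) = 2 ^ n * (P.card * (1 / 2) ^ n) := by linear_combination (-(P.card : ℝ)) * e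
      _ ≤ 2 ^ n * (|LinearMap.det g| * (R + c / 2) ^ n) := by gcongr
      _ = b := by rw [hb, ← e']; ring
  have hpack : packingNumber 1 s ≤ (⌊b⌋₊ : ℕ∞) := by
    refine iSup_le fun C => iSup_le fun hCs => iSup_le fun hC => ?_
    by_contra hlt
    rw [not_le] at hlt
    obtain ⟨t, htC, ht⟩ := Set.exists_subset_encard_eq (Order.add_one_le_of_lt hlt)
    have htf : t.Finite := Set.finite_of_encard_eq_coe (k := ⌊b⌋₊ + 1) (by rw [ht]; rfl)
    have h1 := card_le htf.toFinset (by simpa using htC.trans hCs)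
      (by simpa using hC.subset htC)
    rw [htf.encard_eq_coe_toFinset_card] at ht
    have h2 : htf.toFinset.card = ⌊b⌋₊ + 1 := by exact_mod_cast ht
    rw [h2] at h1
    push_cast at h1
    linarith [Nat.lt_floor_add_one b]
  have hne : packingNumber 1 s ≠ ⊤ := ne_top_of_le_ne_top (ENat.natCast_ne_top _) hpack
  have hcov := isCover_maximalSeparatedSet hne
  have hcard := encard_maximalSeparatedSet hne
  have hfin : (maximalSeparatedSet 1 s).Finite := by
    rw [← Set.encard_ne_top_iff, hcard]
    exact hne
  refine ⟨hfin.toFinset, card_le _ (by simpa using maximalSeparatedSet_subset)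
    (by rw [hfin.coe_toFinset]; exact isSeparated_maximalSeparatedSet), fun x hx => ?_⟩
  obtain ⟨p, hp, hxp⟩ := hcov (mem_image_of_mem g (mem_closedBall_zero_iff.2 hx))
  refine ⟨p, by simpa using hp, ?_⟩
  have h1 : edist (g x) p ≤ 1 := hxp
  rw [edist_dist, dist_eq_norm, ← ENNReal.ofReal_one] at h1
  exact (ENNReal.ofReal_le_ofReal_iff zero_le_one).1 h1

end Covering

variable {d : ℕ}

/-- Up to a constant, the image of the unit ball under `A ^ n` is covered by as many unit balls as
its unstable part has volume: the stable part of the image stays bounded. -/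
theorem exists_finset_cover_pow {A : Matrix (Fin d) (Fin d) ℝ} (hA : IsUnit A)
    (hhyp : IsHyperbolic A) :
    ∃ C : ℝ, ∀ n : ℕ, ∃ P : Finset (Fin d → ℝ), (P.card : ℝ) ≤ C * |unstableDet A| ^ n ∧
      ∀ q : Fin d → ℝ, ‖q‖ ≤ 1 → ∃ p ∈ P, ‖(Matrix.toLin' A ^ n) q - p‖ ≤ 1 := by
  classical
  set L := Matrix.toLin' A with hL
  obtain ⟨v, rfl⟩ := hA
  have hinv : (↑v⁻¹ : Matrix (Fin d) (Fin d) ℝ) * (v : Matrix (Fin d) (Fin d) ℝ) = 1 := v.inv_mul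
  set A := (v : Matrix (Fin d) (Fin d) ℝ)
  set L' := Matrix.toLin' (↑v⁻¹ : Matrix (Fin d) (Fin d) ℝ) with hL'
  have hLL : ∀ x, L' (L x) = x := fun x => by
    rw [hL, hL', ← LinearMap.comp_apply, ← Matrix.toLin'_mul, hinv, Matrix.toLin'_one]
    rfl
  have hLLn : ∀ (n : ℕ) x, (L' ^ n) ((L ^ n) x) = x := by
    intro n
    induction n with
    | zero => simp
    | succ n ih =>
      intro x
      rw [pow_succ, pow_succ', Module.End.mul_apply, Module.End.mul_apply, hLL, ih]
  obtain ⟨c, hc0, hc⟩ := exists_norm_pow_le L' (unstable A) (unstable_le_boundedOrbits hinv)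
  obtain ⟨b, hb0, hb⟩ := exists_norm_pow_le L (boundedOrbits L) le_rfl
  let Φ : (unstable A × boundedOrbits L) →ₗ[ℝ] (Fin d → ℝ) :=
    (unstable A).subtype.coprod (boundedOrbits L).subtype
  have hΦ : LinearMap.range Φ = ⊤ := by
    rw [LinearMap.range_coprod, Submodule.range_subtype, Submodule.range_subtype,
      unstable_sup_boundedOrbits hhyp]
  obtain ⟨G, hG⟩ := LinearMap.exists_rightInverse_of_surjective Φ hΦ
  set κ := ‖LinearMap.toContinuousLinearMap G‖ with hκ
  have hκ0 : 0 ≤ κ := norm_nonneg (LinearMap.toContinuousLinearMap G)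
  have hGq : ∀ q : Fin d → ℝ, ‖q‖ ≤ 1 → ‖G q‖ ≤ κ := fun q hq => by
    simpa using (LinearMap.toContinuousLinearMap G).le_of_opNorm_le_of_le le_rfl hq
  -- `1 + b * κ` bounds the error of the unstable cover plus the image of the stable part.
  obtain ⟨P₀, -, hcov₀⟩ := exists_finset_cover_image (LinearMap.id (R := ℝ) (M := Fin d → ℝ))
    (c := 1) (R := 1 + b * κ) zero_le_one (by positivity) (by simp)
  set r := L.restrict (unstable_invariant A) with hr
  have hrn : ∀ (n : ℕ) (x : unstable A), (((r ^ n) x : unstable A) : Fin d → ℝ) = (L ^ n) x := by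
    intro n
    induction n with
    | zero => simp
    | succ n ih =>
      intro x
      rw [pow_succ, pow_succ, Module.End.mul_apply, Module.End.mul_apply, ih]
      rfl
  refine ⟨(2 * κ + c) ^ Module.finrank ℝ (unstable A) * P₀.card, fun n => ?_⟩
  obtain ⟨P, hP, hcov⟩ := exists_finset_cover_image (r ^ n) hc0 hκ0 (fun x => by
    have h := hc n ((r ^ n) x : unstable A) (Subtype.mem _)
    rw [show (L' ^ n) ((r ^ n) x : unstable A) = x by rw [hrn, hLLn]] at h
    exact h)
  refine ⟨Finset.image₂ (fun (p : unstable A) p₀ => (p : Fin d → ℝ) + p₀) P P₀, ?_, fun q hq => ?_⟩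
  · calc _ ≤ ((P.card * P₀.card : ℕ) : ℝ) := Nat.cast_le.2 (Finset.card_image₂_le _ _ _)
      _ ≤ _ := by
        push_cast
        rw [map_pow, abs_pow] at hP
        calc _ ≤ _ := mul_le_mul_of_nonneg_right hP (Nat.cast_nonneg _)
          _ = _ := by rw [unstableDet]; ring
  · have h1 := hGq q hq
    have hq' : ((G q).1 : Fin d → ℝ) + ((G q).2 : Fin d → ℝ) = q := by
      have := LinearMap.congr_fun hG q
      simpa [Φ] using this
    obtain ⟨p, hp, hp1⟩ := hcov (G q).1 ((norm_fst_le _).trans h1)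
    have h2 : ‖(L ^ n) (G q).2‖ ≤ b * κ :=
      (hb n _ (G q).2.2).trans (mul_le_mul_of_nonneg_left ((norm_snd_le _).trans h1) hb0)
    have hp2 : ‖(L ^ n) (G q).1 - p‖ ≤ 1 := by
      rw [← hrn]
      exact hp1
    obtain ⟨p₀, hp₀, hp₀1⟩ := hcov₀ ((L ^ n) q - p) (by
      rw [← hq', map_add, add_sub_right_comm]
      exact (norm_add_le _ _).trans (add_le_add hp2 h2))
    refine ⟨p + p₀, Finset.mem_image₂_of_mem hp hp₀, ?_⟩
    rw [← sub_sub]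
    exact hp₀1

/-! ### Control sets and linear systems -/

section Concat

variable {X V : Type*} {F : X → V → X}

/-- The control that follows `u` for the first `k` steps and then switches to `v`. -/
def concat (k : ℕ) (u v : ℕ → V) : ℕ → V := fun j => if j < k then u j else v (j - k)

theorem concat_of_lt {k j : ℕ} (u v : ℕ → V) (h : j < k) : concat k u v j = u j := if_pos h

theorem concat_add (k j : ℕ) (u v : ℕ → V) : concat k u v (k + j) = v j := by
  simp [concat]

theorem traj_congr {k : ℕ} (x : X) {u v : ℕ → V} (h : ∀ i < k, u i = v i) :
    traj F k x u = traj F k x v := by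
  induction k with
  | zero => rfl
  | succ k ih =>
    rw [traj, traj, ih fun i hi => h i (Nat.lt_succ_of_lt hi), h k (Nat.lt_succ_self k)]

theorem traj_add (k j : ℕ) (x : X) (u : ℕ → V) :
    traj F (k + j) x u = traj F j (traj F k x u) (fun i => u (k + i)) := by
  induction j with
  | zero => rfl
  | succ j ih => rw [← add_assoc, traj, traj, ih]

theorem traj_concat_of_le {k j : ℕ} (h : j ≤ k) (x : X) (u v : ℕ → V) :
    traj F j x (concat k u v) = traj F j x u :=
  traj_congr x fun _ hi => concat_of_lt u v (hi.trans_le h)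

theorem traj_concat_add (k j : ℕ) (x : X) (u v : ℕ → V) :
    traj F (k + j) x (concat k u v) = traj F j (traj F k x u) v := by
  rw [traj_add, traj_concat_of_le le_rfl]
  exact traj_congr _ fun i _ => concat_add k i u v

theorem reachable_trans {x y z : X} (hxy : y ∈ reachable F x) (hyz : z ∈ reachable F y) :
    z ∈ reachable F x := by
  obtain ⟨k, hk, u, rfl⟩ := hxy
  obtain ⟨j, hj, v, rfl⟩ := hyz
  exact ⟨k + j, by omega, concat k u v, traj_concat_add k j x u v⟩

end Concat

section ControlSets

variable {X V : Type*} [TopologicalSpace X] {F : X → V → X} {D : Set X}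

theorem continuous_traj (hF : ∀ v, Continuous fun x => F x v) (k : ℕ) (u : ℕ → V) :
    Continuous fun x => traj F k x u := by
  induction k with
  | zero => exact continuous_id
  | succ k ih => exact (hF (u k)).comp ih

theorem mem_closure_reachable_of_reachable (hF : ∀ v, Continuous fun x => F x v) {w x y : X}
    (hx : x ∈ closure (reachable F w)) (hy : y ∈ reachable F x) :
    y ∈ closure (reachable F w) := by
  obtain ⟨k, hk, u, rfl⟩ := hy
  exact map_mem_closure (f := fun x => traj F k x u) (continuous_traj hF k u) hx fun z hz =>
    reachable_trans hz ⟨k, hk, u, rfl⟩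

/-- The no-return property of control sets: adding a trajectory piece that starts and ends in
a control set preserves both defining properties, so by maximality the piece lies in the set. -/
theorem IsControlSet.traj_mem (hF : ∀ v, Continuous fun x => F x v) (hD : IsControlSet F D)
    {x : X} (hx : x ∈ D) {k : ℕ} {u : ℕ → V} (hk : traj F k x u ∈ D) {j : ℕ} (hj : j ≤ k) :
    traj F j x u ∈ D := by
  obtain ⟨⟨hne, happ, hinv⟩, hmax⟩ := hD
  set O : Set X := {y | ∃ j ≤ k, traj F j x u = y} with hO
  have hreach : ∀ i < k, traj F k x u ∈ reachable F (traj F i x u) := fun i hi =>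
    ⟨k - i, by omega, fun n => u (i + n), by rw [← traj_add, Nat.add_sub_of_le hi.le]⟩
  have hDO : ∀ a ∈ D, D ∪ O ⊆ closure (reachable F a) := by
    rintro a ha y (hy | ⟨i, hi, rfl⟩)
    · exact happ a ha hy
    · rcases Nat.eq_zero_or_pos i with rfl | h
      · exact happ a ha hx
      · exact mem_closure_reachable_of_reachable hF (happ a ha hx) ⟨i, h, u, rfl⟩
  refine hmax (y := D ∪ O) ⟨hne.mono subset_union_left, ?_, ?_⟩ subset_union_left
    (Or.inr ⟨j, hj, rfl⟩)
  · rintro a (ha | ⟨i, hi, rfl⟩)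
    · exact hDO a ha
    · rcases hi.eq_or_lt with rfl | hi
      · exact hDO _ hk
      · exact (hDO _ hk).trans (closure_mono fun y hy => reachable_trans (hreach i hi) hy)
  · rintro a (ha | ⟨i, hi, rfl⟩)
    · obtain ⟨w, hw⟩ := hinv a ha
      exact ⟨w, fun n hn => Or.inl (hw n hn)⟩
    · obtain ⟨w, hw⟩ := hinv _ hk
      refine ⟨concat (k - i) (fun n => u (i + n)) w, fun n hn => ?_⟩
      rcases le_or_gt n (k - i) with h | h
      · rw [traj_concat_of_le h, ← traj_add]
        exact Or.inr ⟨i + n, by omega, rfl⟩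
      · obtain ⟨l, rfl⟩ := Nat.exists_eq_add_of_lt h
        rw [add_assoc, traj_concat_add, ← traj_add, Nat.add_sub_of_le hi]
        exact Or.inl (hw _ (by omega))

/-- Each point of a control set can be steered into any open subset meeting it, and the same
control keeps nearby points of the control set in it until they are in the open subset as well. -/
theorem IsControlSet.exists_steering (hF : ∀ v, Continuous fun x => F x v)
    (hD : IsControlSet F D) {W : Set X} (hW : IsOpen W) (hWD : W ⊆ D) (hne : W.Nonempty) {x : X}
    (hx : x ∈ D) :
    ∃ (k : ℕ) (u : ℕ → V), ∃ N ∈ 𝓝 x, ∀ y ∈ N ∩ D, traj F k y u ∈ W ∧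
      ∀ j ≤ k, traj F j y u ∈ D := by
  obtain ⟨w, hw⟩ := hne
  obtain ⟨z, hzW, k, hk, u, rfl⟩ := mem_closure_iff.1 (hD.prop.2.1 x hx (hWD hw)) W hW hw
  refine ⟨k, u, _, (continuous_traj hF k u).continuousAt.preimage_mem_nhds (hW.mem_nhds hzW), ?_⟩
  rintro y ⟨hy, hyD⟩
  exact ⟨hy, fun j hj => hD.traj_mem hF hyD (hWD hy) hj⟩

/-- Compactness turns `IsControlSet.exists_steering` into finitely many controls. -/
theorem IsControlSet.exists_finite_steering (hF : ∀ v, Continuous fun x => F x v)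
    (hD : IsControlSet F D) {W K : Set X} (hW : IsOpen W) (hWD : W ⊆ D) (hne : W.Nonempty)
    (hK : IsCompact K) (hKD : K ⊆ D) :
    ∃ I : Set (ℕ × (ℕ → V)), I.Finite ∧ ∀ x ∈ K, ∃ p ∈ I, traj F p.1 x p.2 ∈ W ∧
      ∀ j ≤ p.1, traj F j x p.2 ∈ D := by
  have h : ∀ x ∈ K, ∃ (p : ℕ × (ℕ → V)), ∃ N ∈ 𝓝 x, ∀ y ∈ N ∩ D, traj F p.1 y p.2 ∈ W ∧
      ∀ j ≤ p.1, traj F j y p.2 ∈ D := fun x hx => by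
    obtain ⟨k, u, h⟩ := hD.exists_steering hF hW hWD hne (hKD hx)
    exact ⟨(k, u), h⟩
  obtain ⟨z, hz⟩ := hD.prop.1
  obtain ⟨w, -⟩ := hD.prop.2.2 z hz
  have : Nonempty (ℕ → V) := ⟨w⟩
  choose! p N hN hp using h
  obtain ⟨t, htK, ht⟩ := hK.elim_nhds_subcover N hN
  refine ⟨p '' (t : Set X), t.finite_toSet.image p, fun x hx => ?_⟩
  obtain ⟨y, hy, hxy⟩ := mem_iUnion₂.1 (ht hx)
  exact ⟨p y, mem_image_of_mem p hy, hp y (htK y hy) x ⟨hxy, hKD hx⟩⟩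

end ControlSets

section LinearSystems

variable {d m : ℕ}

/-- The linear system with unrestricted controls. -/
def freeSys (A : Matrix (Fin d) (Fin d) ℝ) (B : Matrix (Fin d) (Fin m) ℝ) :
    (Fin d → ℝ) → (Fin m → ℝ) → (Fin d → ℝ) :=
  fun x v => A *ᵥ x + B *ᵥ v

theorem traj_linSys (A : Matrix (Fin d) (Fin d) ℝ) (B : Matrix (Fin d) (Fin m) ℝ)
    (U : Set (Fin m → ℝ)) (k : ℕ) (x : Fin d → ℝ) (u : ℕ → U) :
    traj (linSys A B U) k x u = traj (freeSys A B) k x (fun i => (u i : Fin m → ℝ)) := by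
  induction k with
  | zero => rfl
  | succ k ih => rw [traj, traj, ih]; rfl

theorem continuous_linSys (A : Matrix (Fin d) (Fin d) ℝ) (B : Matrix (Fin d) (Fin m) ℝ)
    (U : Set (Fin m → ℝ)) (u : U) : Continuous fun x => linSys A B U x u :=
  (continuous_const.matrix_mulVec continuous_id).add continuous_const

theorem traj_freeSys_add_smul (A : Matrix (Fin d) (Fin d) ℝ) (B : Matrix (Fin d) (Fin m) ℝ)
    (k : ℕ) (x y : Fin d → ℝ) (u v : ℕ → Fin m → ℝ) (ρ : ℝ) :
    traj (freeSys A B) k (x + ρ • y) (fun i => u i + ρ • v i) =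
      traj (freeSys A B) k x u + ρ • traj (freeSys A B) k y v := by
  induction k with
  | zero => rfl
  | succ k ih =>
    simp only [traj, ih, freeSys, Matrix.mulVec_add, Matrix.mulVec_smul, smul_add]
    abel

theorem traj_freeSys_eq (A : Matrix (Fin d) (Fin d) ℝ) (B : Matrix (Fin d) (Fin m) ℝ)
    (k : ℕ) (x : Fin d → ℝ) (v : ℕ → Fin m → ℝ) :
    traj (freeSys A B) k x v = (Matrix.toLin' A ^ k) x + traj (freeSys A B) k 0 v := by
  induction k with
  | zero => simp [traj]
  | succ k ih =>
    simp only [traj, freeSys] at ih ⊢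
    rw [ih, Matrix.mulVec_add, pow_succ', Module.End.mul_apply, Matrix.toLin'_apply]
    abel

theorem exists_traj_eq_sum (A : Matrix (Fin d) (Fin d) ℝ) (B : Matrix (Fin d) (Fin m) ℝ)
    (T : ℕ) (w : ℕ → Fin m → ℝ) :
    ∃ v : ℕ → Fin m → ℝ, traj (freeSys A B) T 0 v =
      ∑ j ∈ Finset.range T, (A ^ j * B) *ᵥ w j := by
  induction T generalizing w with
  | zero => exact ⟨0, by simp [traj]⟩
  | succ T ih =>
    obtain ⟨v, hv⟩ := ih fun j => w (j + 1)
    refine ⟨fun j => if j < T then v j else w 0, ?_⟩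
    rw [traj, traj_congr (v := v) 0 fun i hi => if_pos hi, hv, Finset.sum_range_succ']
    simp [freeSys, Matrix.mulVec_sum, pow_succ', Matrix.mul_assoc]

/-- By the Kalman rank condition, each point can be reached from the origin in any time
`T ≥ d`. -/
theorem IsControllable.exists_traj_eq {A : Matrix (Fin d) (Fin d) ℝ}
    {B : Matrix (Fin d) (Fin m) ℝ} (h : IsControllable A B) {T : ℕ} (hT : d ≤ T)
    (y : Fin d → ℝ) : ∃ v : ℕ → Fin m → ℝ, traj (freeSys A B) T 0 v = y := by
  have hr : LinearMap.range (kalmanMatrix A B).mulVecLin = ⊤ := by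
    refine Submodule.eq_top_of_finrank_eq ?_
    rw [← Matrix.rank, Module.finrank_fin_fun]
    exact h
  obtain ⟨w, hw⟩ := LinearMap.range_eq_top.1 hr y
  obtain ⟨v, hv⟩ := exists_traj_eq_sum A B T
    fun j i => if hj : j < d then w (⟨j, hj⟩, i) else 0
  refine ⟨v, hv.trans ?_⟩
  rw [← hw, ← Finset.sum_subset (Finset.range_subset_range.2 hT)]
  · rw [Finset.sum_range]
    ext i
    simp [kalmanMatrix, Matrix.mulVec, dotProduct, Fintype.sum_prod_type]
  · intro j _ hj
    have hj' : ¬ j < d := by simpa using hj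
    simp only [hj', dif_neg, not_false_eq_true]
    exact Matrix.mulVec_zero _

end LinearSystems

/-! ### Concatenated control blocks and the pressure -/

section Blocks

/-- The partial sums of a periodic sequence differ from those of its mean by a bounded amount. -/
theorem exists_sum_range_le_of_periodic {g : ℕ → ℝ} {τ : ℕ} (hτ : 1 ≤ τ)
    (hg : ∀ k, g (k + τ) = g k) :
    ∃ H : ℝ, ∀ l : ℕ, ∑ i ∈ Finset.range l, g i ≤
      H + l * ((1 : ℝ) / τ * ∑ i ∈ Finset.range τ, g i) := by
  set a : ℝ := (1 : ℝ) / τ * ∑ i ∈ Finset.range τ, g i with ha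
  have hτ0 : (τ : ℝ) ≠ 0 := by positivity
  let h : ℕ → ℝ := fun l => ∑ i ∈ Finset.range l, g i - l * a
  have hper : Function.Periodic h τ := by
    intro l
    induction l with
    | zero =>
      simp only [h, zero_add, Finset.range_zero, Finset.sum_empty, Nat.cast_zero, zero_mul, ha]
      field_simp
      ring
    | succ l ih =>
      have e := hg l
      simp only [h] at ih ⊢
      rw [add_right_comm, Finset.sum_range_succ, Finset.sum_range_succ, e]
      push_cast at ih ⊢
      linarith
  refine ⟨∑ r ∈ Finset.range τ, |h r|, fun l => ?_⟩
  have h1 : h l ≤ ∑ r ∈ Finset.range τ, |h r| := by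
    rw [← hper.map_mod_nat l]
    exact (le_abs_self _).trans (Finset.single_le_sum (f := fun r => |h r|)
      (fun r _ => abs_nonneg _) (Finset.mem_range.2 (Nat.mod_lt l hτ)))
  simp only [h] at h1
  linarith

variable {X V : Type*} {F : X → V → X}

/-- If finitely many control blocks of length `T` suffice to return from `W` to `W` through `D`,
then the concatenations of `q` blocks keep the points of `W` in `D` up to time `q * T`. -/
theorem exists_concat_blocks {W D : Set X} {T : ℕ} (𝓑 : Finset (ℕ → V))
    (h𝓑 : ∀ x ∈ W, ∃ b ∈ 𝓑, traj F T x b ∈ W ∧ ∀ j ≤ T, traj F j x b ∈ D) (hWD : W ⊆ D)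
    {f : V → ℝ} {g : ℕ → ℝ} (hg : ∀ k, g (T + k) = g k)
    (hfg : ∀ b ∈ 𝓑, ∀ j < T, f (b j) ≤ g j) (u₀ : ℕ → V) (q : ℕ) :
    ∃ S : Finset (ℕ → V), S.card ≤ 𝓑.card ^ q ∧
      (∀ x ∈ W, ∃ u ∈ S, ∀ j ≤ q * T, traj F j x u ∈ D) ∧
      ∀ u ∈ S, ∀ j < q * T, f (u j) ≤ g j := by
  classical
  induction q with
  | zero =>
    refine ⟨{u₀}, by simp, fun x hx => ⟨u₀, by simp, fun j hj => ?_⟩, fun u _ j hj => ?_⟩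
    · obtain rfl : j = 0 := by omega
      exact hWD hx
    · omega
  | succ q ih =>
    obtain ⟨S, hcard, hS, hfS⟩ := ih
    refine ⟨Finset.image₂ (concat T) 𝓑 S, ?_, fun x hx => ?_, ?_⟩
    · rw [pow_succ']
      exact Finset.card_image₂_le _ _ _ |>.trans (Nat.mul_le_mul_left _ hcard)
    · obtain ⟨b, hb, hbW, hbD⟩ := h𝓑 x hx
      obtain ⟨s, hs, hsD⟩ := hS _ hbW
      refine ⟨concat T b s, Finset.mem_image₂_of_mem hb hs, fun j hj => ?_⟩
      rcases le_or_gt j T with h | h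
      · rw [traj_concat_of_le h]
        exact hbD j h
      · obtain ⟨i, rfl⟩ := Nat.exists_eq_add_of_le h.le
        rw [traj_concat_add]
        refine hsD i ?_
        rw [Nat.succ_mul] at hj
        omega
    · intro u hu j hj
      obtain ⟨b, hb, s, hs, rfl⟩ := Finset.mem_image₂.1 hu
      rcases lt_or_ge j T with h | h
      · rw [concat_of_lt _ _ h]
        exact hfg b hb j h
      · obtain ⟨i, rfl⟩ := Nat.exists_eq_add_of_le h
        rw [concat_add, hg]
        refine hfS s hs i ?_
        rw [Nat.succ_mul] at hj
        omega

theorem spanningInf_le_of_finset {f : V → ℝ} {K D : Set X} {n : ℕ} (S : Finset (ℕ → V))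
    (hS : IsSpanning F n K D S) {c : ℝ} (hc : ∀ u ∈ S, potentialSum f n u ≤ c) :
    spanningInf F f K D n ≤ ENNReal.ofReal (S.card * Real.exp c) := by
  refine (iInf₂_le (S : Set (ℕ → V)) hS).trans ?_
  calc _ ≤ ∑' _ : (S : Set (ℕ → V)), ENNReal.ofReal (Real.exp c) :=
        ENNReal.tsum_le_tsum fun u =>
          ENNReal.ofReal_le_ofReal (Real.exp_le_exp.2 (hc u u.2))
    _ = _ := by
      rw [ENNReal.ofReal_mul (Nat.cast_nonneg _), ENNReal.ofReal_natCast]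
      simp

theorem pressure_le_of_eventually {f : V → ℝ} {K D : Set X} {C θ : ℝ}
    (h : ∀ᶠ n : ℕ in atTop, spanningInf F f K D n ≤ ENNReal.ofReal (Real.exp (C + n * θ))) :
    pressure F f K D ≤ (θ : EReal) := by
  have hlim : Tendsto (fun n : ℕ => ((C / n + θ : ℝ) : EReal)) atTop (𝓝 (θ : EReal)) := by
    refine EReal.tendsto_coe.2 ?_
    simpa using (tendsto_const_div_atTop_nhds_zero_nat C).add_const θ
  rw [pressure, ← hlim.limsup_eq]
  refine limsup_le_limsup ?_
  filter_upwards [h, eventually_ge_atTop 1] with n hn hn1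
  have hn0 : (n : ℝ) ≠ 0 := by positivity
  have h1 := ENNReal.log_monotone hn
  rw [ENNReal.log_ofReal_of_pos (Real.exp_pos _), Real.log_exp] at h1
  calc _ ≤ (((1 : ℝ) / (n : ℝ) : ℝ) : EReal) * ((C + n * θ : ℝ) : EReal) :=
        mul_le_mul_of_nonneg_left h1 (by exact_mod_cast (by positivity : (0 : ℝ) ≤ 1 / n))
    _ = _ := by
      rw [← EReal.coe_mul]
      congr 1
      field_simp

variable [TopologicalSpace X]

/-- Finitely many control blocks of length `T` that return a neighbourhood `W` to itself through
the control set `D` bound the invariance pressure: the points of `K` are first steered into `W`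
by one of finitely many controls, and the blocks are then concatenated. -/
theorem IsControlSet.pressure_le {D : Set X} (hF : ∀ v, Continuous fun x => F x v)
    (hD : IsControlSet F D) {K W : Set X} (hK : IsCompact K) (hKD : K ⊆ D)
    (hW : (interior W).Nonempty) {T : ℕ} (hT : 1 ≤ T) (𝓑 : Finset (ℕ → V))
    (h𝓑 : ∀ x ∈ W, ∃ b ∈ 𝓑, traj F T x b ∈ W ∧ ∀ j ≤ T, traj F j x b ∈ D)
    {f : V → ℝ} {g : ℕ → ℝ} (hg : ∀ k, g (T + k) = g k)
    (hfg : ∀ b ∈ 𝓑, ∀ j < T, f (b j) ≤ g j) {H a : ℝ}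
    (hgsum : ∀ l : ℕ, ∑ i ∈ Finset.range l, g i ≤ H + l * a) :
    pressure F f K D ≤ ((Real.log 𝓑.card / T + a : ℝ) : EReal) := by
  classical
  have hWD : W ⊆ D := fun x hx => by
    obtain ⟨b, -, -, hb⟩ := h𝓑 x hx
    exact hb 0 (Nat.zero_le _)
  obtain ⟨w, hw⟩ := hW
  obtain ⟨u₀, hu₀, -⟩ := h𝓑 w (interior_subset hw)
  have hcard : 1 ≤ 𝓑.card := Finset.card_pos.2 ⟨u₀, hu₀⟩
  have hlog : 0 ≤ Real.log 𝓑.card := Real.log_natCast_nonneg _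
  obtain ⟨I, hI, hIK⟩ := hD.exists_finite_steering hF isOpen_interior
    (interior_subset.trans hWD) ⟨w, hw⟩ hK hKD
  lift I to Finset (ℕ × (ℕ → V)) using hI
  obtain ⟨N, hN⟩ : ∃ N, ∀ p ∈ I, p.1 ≤ N :=
    ⟨I.sup Prod.fst, fun p hp => Finset.le_sup (f := Prod.fst) hp⟩
  let c : ℕ × (ℕ → V) → ℝ := fun p => ∑ j ∈ Finset.range p.1, f (p.2 j) + H - p.1 * a
  set M := ∑ p ∈ I, |c p| with hM
  have hcM : ∀ p ∈ I, c p ≤ M := fun p hp => (le_abs_self _).trans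
    (Finset.single_le_sum (f := fun p => |c p|) (fun _ _ => abs_nonneg _) hp)
  refine pressure_le_of_eventually (C := Real.log (I.card + 1) + Real.log 𝓑.card + M) ?_
  filter_upwards [eventually_ge_atTop N] with n hn
  obtain ⟨S, hScard, hS, hfS⟩ := exists_concat_blocks 𝓑 h𝓑 hWD hg hfg u₀ (n / T + 1)
  have hqT : n ≤ (n / T + 1) * T := by
    rw [mul_comm]
    exact (Nat.lt_mul_div_succ n hT).le
  refine (spanningInf_le_of_finset (Finset.image₂ (fun p s => concat p.1 p.2 s) I S) ?_
    (c := M + n * a) ?_).trans (ENNReal.ofReal_le_ofReal ?_)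
  · intro x hx
    obtain ⟨p, hp, hpW, hpD⟩ := hIK x hx
    obtain ⟨s, hs, hsD⟩ := hS _ (interior_subset hpW)
    refine ⟨concat p.1 p.2 s, Finset.mem_coe.2 (Finset.mem_image₂_of_mem hp hs),
      fun j _ hj => ?_⟩
    rcases le_or_gt j p.1 with h | h
    · rw [traj_concat_of_le h]
      exact hpD j h
    · obtain ⟨i, rfl⟩ := Nat.exists_eq_add_of_le h.le
      rw [traj_concat_add]
      exact hsD i (by omega)
  · intro u hu
    obtain ⟨p, hp, s, hs, rfl⟩ := Finset.mem_image₂.1 hu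
    obtain ⟨l, rfl⟩ := Nat.exists_eq_add_of_le ((hN p hp).trans hn)
    have h1 : ∑ i ∈ Finset.range l, f (s i) ≤ H + l * a :=
      (Finset.sum_le_sum fun i hi => hfS s hs i (by
        have := Finset.mem_range.1 hi
        omega)).trans (hgsum l)
    have h2 := hcM p hp
    simp only [c] at h2
    rw [potentialSum, Finset.sum_range_add]
    simp only [concat_add]
    rw [Finset.sum_congr rfl fun j hj => by rw [concat_of_lt _ _ (Finset.mem_range.1 hj)]]
    push_cast
    linarith
  · have h1 : ((Finset.image₂ (fun p s => concat p.1 p.2 s) I S).card : ℝ) ≤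
        (I.card + 1) * (𝓑.card : ℝ) ^ (n / T + 1) := by
      calc _ ≤ ((I.card * S.card : ℕ) : ℝ) := Nat.cast_le.2 (Finset.card_image₂_le _ _ _)
        _ ≤ (((I.card + 1) * 𝓑.card ^ (n / T + 1) : ℕ) : ℝ) :=
          Nat.cast_le.2 (Nat.mul_le_mul (Nat.le_succ _) hScard)
        _ = _ := by push_cast; rfl
    have hb0 : (0 : ℝ) < 𝓑.card := by exact_mod_cast hcard
    have h2 : (𝓑.card : ℝ) ^ (n / T + 1) ≤
        Real.exp (Real.log 𝓑.card + n * (Real.log 𝓑.card / T)) := by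
      rw [← Real.exp_log (pow_pos hb0 _), Real.log_pow]
      refine Real.exp_le_exp.2 ?_
      have : ((n / T : ℕ) : ℝ) ≤ n / T := Nat.cast_div_le
      have := mul_le_mul_of_nonneg_right this hlog
      push_cast
      calc _ = Real.log 𝓑.card + ((n / T : ℕ) : ℝ) * Real.log 𝓑.card := by ring
        _ ≤ Real.log 𝓑.card + (n / T : ℝ) * Real.log 𝓑.card := by linarith
        _ = _ := by ring
    have h3 : (I.card + 1 : ℝ) = Real.exp (Real.log (I.card + 1)) :=
      (Real.exp_log (by positivity)).symm
    calc _ ≤ ((I.card + 1) * (𝓑.card : ℝ) ^ (n / T + 1)) * Real.exp (M + n * a) :=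
          mul_le_mul_of_nonneg_right h1 (Real.exp_pos _).le
      _ ≤ (Real.exp (Real.log (I.card + 1)) *
          Real.exp (Real.log 𝓑.card + n * (Real.log 𝓑.card / T))) * Real.exp (M + n * a) := by
        rw [← h3]
        exact mul_le_mul_of_nonneg_right
          (mul_le_mul_of_nonneg_left h2 (Nat.cast_add_one_pos _).le) (Real.exp_pos _).le
      _ = _ := by
        rw [← Real.exp_add, ← Real.exp_add]
        congr 1
        ring

end Blocks

/-! ### Blocks along a periodic trajectory -/

section Periodic

variable {d m : ℕ}

/-- Near a periodic trajectory in `int D` with controls in `int U`, the control blocks of the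
linear system that return the unit ball to itself can be scaled down and added to the periodic
control. This yields the bound for the pressure up to an arbitrary error `ε`. -/
theorem pressure_le_of_isPeriodicPair
    {A : Matrix (Fin d) (Fin d) ℝ} {B : Matrix (Fin d) (Fin m) ℝ} {U : Set (Fin m → ℝ)}
    (hA : IsUnit A) (hAB : IsControllable A B) (hhyp : IsHyperbolic A)
    {D : Set (Fin d → ℝ)} (hD : IsControlSet (linSys A B U) D) (f : C(U, ℝ))
    {K : Set (Fin d → ℝ)} (hK : IsCompact K) (hKD : K ⊆ D) {τ : ℕ} {x : Fin d → ℝ} {u : ℕ → U}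
    (h : IsPeriodicPair A B U D τ x u) {ε : ℝ} (hε : 0 < ε) :
    pressure (linSys A B U) f K D ≤ ((Real.log |unstableDet A| +
      (1 : ℝ) / τ * ∑ i ∈ Finset.range τ, f (u i) + ε : ℝ) : EReal) := by
  classical
  obtain ⟨hτ, hdτ, hu, hx, hxD, huU⟩ := h
  obtain ⟨C, hC⟩ := exists_finset_cover_pow hA hhyp
  -- The constant of the covering estimate becomes negligible for long blocks.
  obtain ⟨s, hs⟩ := exists_nat_gt (max 1 (2 * |Real.log C| / ε))
  have hs1 : 1 ≤ s := by
    have := (le_max_left _ _).trans_lt hs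
    exact_mod_cast this.le
  set T := s * τ with hT
  have hτT : τ ≤ T := Nat.le_mul_of_pos_left τ hs1
  have hT1 : 1 ≤ T := hτ.trans hτT
  have hT0 : (0 : ℝ) < T := by exact_mod_cast hT1
  have hlogC : Real.log C / T ≤ ε / 2 := by
    have h1 : 2 * |Real.log C| / ε < s := (le_max_right _ _).trans_lt hs
    rw [div_lt_iff₀ hε] at h1
    have h2 : (s : ℝ) ≤ T := by exact_mod_cast Nat.le_mul_of_pos_right s hτ
    rw [div_le_iff₀ hT0]
    have h3 := mul_le_mul_of_nonneg_right h2 hε.le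
    linarith [le_abs_self (Real.log C)]
  obtain ⟨P, hPcard, hP⟩ := hC T
  have huT : ∀ k, u (k + T) = u k := (show Function.Periodic u τ from hu).nat_mul s
  have hxT : traj (linSys A B U) T x u = x := by
    have := (show Function.Periodic (fun k => traj (linSys A B U) k x u) τ from hx).nat_mul s 0
    simpa [traj] using this
  have huU' : ∀ i, (u i : Fin m → ℝ) ∈ interior U := fun i => by
    rw [← (show Function.Periodic u τ from hu).map_mod_nat i]
    exact huU _ (Nat.mod_lt i hτ)
  choose v hv using fun p : Fin d → ℝ => hAB.exists_traj_eq (hdτ.trans hτT) (-p)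
  -- All conditions on the scaling factor are open at `0` and finite in number.
  have hctrl : ∀ p ∈ P, ∀ j ∈ Finset.range T, ∀ᶠ ρ : ℝ in 𝓝 0,
      ∃ hU : (u j : Fin m → ℝ) + ρ • v p j ∈ U, f ⟨_, hU⟩ ≤ f (u j) + ε / 2 := by
    intro p _ j _
    have hcont : Tendsto (fun ρ : ℝ => (u j : Fin m → ℝ) + ρ • v p j) (𝓝 0) (𝓝 (u j)) := by
      have : Continuous fun ρ : ℝ => (u j : Fin m → ℝ) + ρ • v p j := by fun_prop
      simpa using this.tendsto 0
    have h1 : ∀ᶠ w : U in 𝓝 (u j), f w < f (u j) + ε / 2 :=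
      f.continuous.continuousAt.eventually (gt_mem_nhds (by linarith))
    rw [nhds_subtype_eq_comap, eventually_comap] at h1
    filter_upwards [hcont.eventually h1, hcont.eventually (mem_interior_iff_mem_nhds.1 (huU' j))]
      with ρ h2 h3
    exact ⟨h3, (h2 ⟨_, h3⟩ rfl).le⟩
  have hstate : ∀ p ∈ P, ∀ j ∈ Finset.range (T + 1), ∀ᶠ ρ : ℝ in 𝓝 0,
      ∀ q : Fin d → ℝ, ‖q‖ ≤ 1 →
        traj (linSys A B U) j x u + ρ • traj (freeSys A B) j q (v p) ∈ D := by
    intro p _ j _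
    have hcont : Continuous fun q => traj (freeSys A B) j q (v p) :=
      continuous_traj (F := freeSys A B)
        (fun w => (continuous_const.matrix_mulVec continuous_id).add continuous_const) j (v p)
    obtain ⟨M, hM⟩ := (isCompact_closedBall (0 : Fin d → ℝ) 1).exists_bound_of_continuousOn
      hcont.continuousOn
    obtain ⟨r, hr, hball⟩ := Metric.mem_nhds_iff.1 (mem_interior_iff_mem_nhds.1 (hxD j))
    have hρ : ∀ᶠ ρ : ℝ in 𝓝 0, |ρ| * M < r := by
      have : Continuous fun ρ : ℝ => |ρ| * M := by fun_prop
      exact this.continuousAt.eventually (gt_mem_nhds (by simpa using hr))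
    filter_upwards [hρ] with ρ hρ q hq
    refine hball ?_
    rw [mem_ball_iff_norm, add_sub_cancel_left, norm_smul, Real.norm_eq_abs]
    exact (mul_le_mul_of_nonneg_left (hM q (mem_closedBall_zero_iff.2 hq))
      (abs_nonneg ρ)).trans_lt hρ
  obtain ⟨ρ, ⟨hρU, hρD⟩, hρ⟩ : ∃ ρ : ℝ, ((∀ p ∈ P, ∀ j ∈ Finset.range T,
      ∃ hU : (u j : Fin m → ℝ) + ρ • v p j ∈ U, f ⟨_, hU⟩ ≤ f (u j) + ε / 2) ∧
      ∀ p ∈ P, ∀ j ∈ Finset.range (T + 1), ∀ q : Fin d → ℝ, ‖q‖ ≤ 1 →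
        traj (linSys A B U) j x u + ρ • traj (freeSys A B) j q (v p) ∈ D) ∧ 0 < ρ := by
    have h1 := (eventually_all_finset P).2 fun p hp => (eventually_all_finset _).2 (hctrl p hp)
    have h2 := (eventually_all_finset P).2 fun p hp => (eventually_all_finset _).2 (hstate p hp)
    exact (((h1.and h2).filter_mono nhdsWithin_le_nhds).and
      (self_mem_nhdsWithin : Ioi (0 : ℝ) ∈ 𝓝[>] 0)).exists
  let b : (Fin d → ℝ) → ℕ → U := fun p j =>
    if hU : (u j : Fin m → ℝ) + ρ • v p j ∈ U then ⟨_, hU⟩ else u j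
  have hb : ∀ p ∈ P, ∀ j < T, (b p j : Fin m → ℝ) = u j + ρ • v p j := fun p hp j hj => by
    obtain ⟨hU, -⟩ := hρU p hp j (Finset.mem_range.2 hj)
    simp only [b, dif_pos hU]
  have htraj : ∀ p ∈ P, ∀ (q : Fin d → ℝ), ∀ j ≤ T, traj (linSys A B U) j (x + ρ • q) (b p) =
      traj (linSys A B U) j x u + ρ • traj (freeSys A B) j q (v p) := fun p hp q j hj => by
    rw [traj_linSys, traj_linSys, ← traj_freeSys_add_smul]
    exact traj_congr _ fun i hi => hb p hp i (hi.trans_le hj)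
  have hW : (interior (Metric.closedBall x ρ)).Nonempty :=
    ⟨x, Metric.ball_subset_interior_closedBall (Metric.mem_ball_self hρ)⟩
  obtain ⟨H, hH⟩ := exists_sum_range_le_of_periodic (g := fun i => f (u i)) hτ
    fun k => by rw [hu]
  set a : ℝ := (1 : ℝ) / τ * ∑ i ∈ Finset.range τ, f (u i) with ha
  refine (hD.pressure_le (continuous_linSys A B U) hK hKD hW hT1 (P.image b) ?_
    (g := fun j => f (u j) + ε / 2) (fun k => by rw [add_comm T k, huT]) ?_ (H := H)
    (a := a + ε / 2) fun l => ?_).trans (EReal.coe_le_coe_iff.2 ?_)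
  · intro y hy
    set q := ρ⁻¹ • (y - x) with hq
    have hyq : y = x + ρ • q := by
      rw [hq, smul_smul, mul_inv_cancel₀ hρ.ne', one_smul, add_sub_cancel]
    have hq1 : ‖q‖ ≤ 1 := by
      rw [mem_closedBall_iff_norm] at hy
      rw [hq, norm_smul, norm_inv, Real.norm_eq_abs, abs_of_pos hρ, inv_mul_le_iff₀ hρ, mul_one]
      exact hy
    obtain ⟨p, hp, hpq⟩ := hP q hq1
    refine ⟨b p, Finset.mem_image_of_mem b hp, ?_, fun j hj => ?_⟩
    · rw [hyq, htraj p hp q T le_rfl, hxT, traj_freeSys_eq, hv, ← sub_eq_add_neg,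
        mem_closedBall_iff_norm, add_sub_cancel_left, norm_smul, Real.norm_eq_abs, abs_of_pos hρ]
      exact mul_le_of_le_one_right hρ.le hpq
    · rw [hyq, htraj p hp q j hj]
      exact hρD p hp j (Finset.mem_range.2 (Nat.lt_succ_of_le hj)) q hq1
  · intro w hw j hj
    obtain ⟨p, hp, rfl⟩ := Finset.mem_image.1 hw
    obtain ⟨hU, hf⟩ := hρU p hp j (Finset.mem_range.2 hj)
    simpa only [b, dif_pos hU] using hf
  · rw [Finset.sum_add_distrib, Finset.sum_const, Finset.card_range, nsmul_eq_mul]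
    have := hH l
    linarith
  · obtain ⟨p, hp, -⟩ := hP 0 (by simp)
    have hPpos : 0 < (P.image b).card := Finset.card_pos.2 ⟨_, Finset.mem_image_of_mem b hp⟩
    have hle : ((P.image b).card : ℝ) ≤ C * |unstableDet A| ^ T :=
      (Nat.cast_le.2 Finset.card_image_le).trans hPcard
    have hpos : 0 < C * |unstableDet A| ^ T := (Nat.cast_pos.2 hPpos).trans_le hle
    have hlog := Real.log_le_log (Nat.cast_pos.2 hPpos) hle
    rw [Real.log_mul (left_ne_zero_of_mul hpos.ne') (right_ne_zero_of_mul hpos.ne'),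
      Real.log_pow] at hlog
    have h1 := div_le_div_of_nonneg_right hlog hT0.le
    rw [add_div, mul_div_cancel_left₀ _ hT0.ne'] at h1
    linarith

end Periodic

end InvPressure

theorem corollary6p2 {d m : ℕ}
    (A : Matrix (Fin d) (Fin d) ℝ) (B : Matrix (Fin d) (Fin m) ℝ) (U : Set (Fin m → ℝ))
    (hA : IsUnit A)
    (hUcompact : IsCompact U) (hUconvex : Convex ℝ U) (hU0 : U ∈ 𝓝 (0 : Fin m → ℝ))
    (hUreg : U = closure (interior U))
    (hAB : InvPressure.IsControllable A B) (hhyp : InvPressure.IsHyperbolic A)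
    (D : Set (Fin d → ℝ)) (hD : InvPressure.IsControlSet (InvPressure.linSys A B U) D)
    (hDint : (interior D).Nonempty)
    (f : C(U, ℝ))
    (K : Set (Fin d → ℝ)) (hK : IsCompact K) (hKD : K ⊆ D) (hKint : (interior K).Nonempty) :
    InvPressure.pressure (InvPressure.linSys A B U) f K D ≤
      ((Real.log |InvPressure.unstableDet A| : ℝ) : EReal) +
        ⨅ (τ : ℕ) (x : Fin d → ℝ) (u : ℕ → U)
          (_ : InvPressure.IsPeriodicPair A B U D τ x u),
          (((1 : ℝ) / (τ : ℝ) * ∑ i ∈ Finset.range τ, f (u i) : ℝ) : EReal) := by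
  rw [add_comm, ← EReal.sub_le_iff_le_add (.inl (EReal.coe_ne_bot _)) (.inl (EReal.coe_ne_top _))]
  refine le_iInf fun τ => le_iInf fun x => le_iInf fun u => le_iInf fun h => ?_
  rw [EReal.sub_le_iff_le_add (.inl (EReal.coe_ne_bot _)) (.inl (EReal.coe_ne_top _)),
    ← EReal.coe_add, add_comm, ← EReal.le_of_forall_lt_iff_le]
  intro z hz
  refine (InvPressure.pressure_le_of_isPeriodicPair hA hAB hhyp hD f hK hKD h
    (sub_pos.2 (EReal.coe_lt_coe_iff.1 hz))).trans (EReal.coe_le_coe_iff.2 ?_)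
  exact (add_sub_cancel _ _).le
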